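/- Let $\tau\in\mathbb{C}$ with $\operatorname{Im}\tau>0$, write $\mathrm{e}(x)=e^{2\pi \mathrm{i}x}$ and $q=\mathrm{e}(\tau)$, and let $$\theta_\tau(\upsilon)=\frac1{\mathrm{i}}\sum_{n=-\infty}^{\infty}(-1)^n e^{\pi \mathrm{i}\tau(n+\frac12)^2}\,\mathrm{e}\big((2n+1)\upsilon/2\big),\qquad \Delta_\tau(a,b)=\frac{\theta_\tau'(0)\,\theta_\tau(a+b)}{\theta_\tau(a)\,\theta_\tau(b)} .$$ Let $\delta$ be the function on $\mathbb{C}^*\times\mathbb{C}^*$ determined by $\delta(\mathrm{e}(a),\mathrm{e}(b))=\frac1{2\pi \mathrm{i}}\Delta_\tau(a,b)$; it is well defined because $\Delta_\tau(a,b)$ has period $1$ in $a$ and in $b$. For $t,h\in\mathbb{C}^*$ and $\lambda\in\mathbb{C}$ put $$\Phi(\lambda)=\delta(\mathrm{e}(\lambda)t,h)\cdot\delta(\mathrm{e}(-\lambda)t,h).$$ Then, as meromorphic functions of $t$ and $h$, and more precisely for all $t,h\in\mathbb{C}^*$ such that $t^4\neq q^n$ and $h\neq q^n$ for every integer $n$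 (that is, away from the poles of the factors occurring in the formula), $$\delta(t^{-2},h)\cdot\delta(t^4,h)=\frac18\sum_{k,\ell=0}^{3}(-1)^{(k+1)(\ell+1)}\,\Phi\!\left(\frac k4-\frac\ell4\tau\right).$$ -/

import Mathlib

noncomputable section

namespace ThetaD4

/-- `e(x) = exp(2 π i x)`. -/
def e (x : ℂ) : ℂ := Complex.exp (2 * Real.pi * Complex.I * x)

/-- The Jacobi theta function
`θ_τ(υ) = (1/i) ∑_{n ∈ ℤ} (-1)^n q₀^{(n + 1/2)²} e((2n+1)υ/2)`, where `q₀^s` means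
`exp(π i τ s)`. The series converges absolutely for `0 < Im τ`. -/
def theta (τ υ : ℂ) : ℂ :=
  (1 / Complex.I) * ∑' n : ℤ, (-1 : ℂ) ^ n *
    Complex.exp (Real.pi * Complex.I * τ * ((n : ℂ) + 1 / 2) ^ 2) *
    e ((2 * (n : ℂ) + 1) * υ / 2)

/-- `Δ_τ(a, b) = θ_τ'(0) θ_τ(a + b) / (θ_τ(a) θ_τ(b))`. -/
def Delta (τ a b : ℂ) : ℂ :=
  deriv (theta τ) 0 * theta τ (a + b) / (theta τ a * theta τ b)

/-- The function `δ` on `ℂ* × ℂ*`, the multiplicative form of `Δ`: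
`δ(e(a), e(b)) = Δ(a, b) / (2 π i)`. The logarithms `a`, `b` of the arguments are
chosen here by the principal branch; `delta_e` shows that the choice is irrelevant. -/
def delta (τ A B : ℂ) : ℂ :=
  1 / (2 * Real.pi * Complex.I) *
    Delta τ (Complex.log A / (2 * Real.pi * Complex.I))
      (Complex.log B / (2 * Real.pi * Complex.I))

/-- `Φ(λ) = δ(e(λ) t, h) δ(e(-λ) t, h)`, with `x` in the role of `λ`. -/
def Phi (τ t h x : ℂ) : ℂ :=
  delta τ (e x * t) h * delta τ (e (-x) * t) h

theorem theta_add_one (τ υ : ℂ) : theta τ (υ + 1) = -theta τ υ := by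
  unfold theta
  rw [← mul_neg, ← tsum_neg]
  congr 1
  refine tsum_congr fun n => ?_
  have h : e ((2 * (n : ℂ) + 1) * (υ + 1) / 2) = -e ((2 * (n : ℂ) + 1) * υ / 2) := by
    unfold e
    have : 2 * (Real.pi : ℂ) * Complex.I * ((2 * (n : ℂ) + 1) * (υ + 1) / 2) =
        2 * Real.pi * Complex.I * ((2 * (n : ℂ) + 1) * υ / 2) + Real.pi * Complex.I
          + n * (2 * Real.pi * Complex.I) := by ring
    rw [this, Complex.exp_add, Complex.exp_int_mul_two_pi_mul_I, Complex.exp_add,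
      Complex.exp_pi_mul_I]
    ring
  rw [h]
  ring

theorem Delta_comm (τ a b : ℂ) : Delta τ a b = Delta τ b a := by
  unfold Delta
  rw [add_comm a b, mul_comm (theta τ a)]

theorem Delta_add_int_left (τ a b : ℂ) (n : ℤ) : Delta τ (a + n) b = Delta τ a b := by
  have h1 : Function.Periodic (fun x => Delta τ x b) 1 := by
    intro x
    unfold Delta
    beta_reduce
    rw [add_right_comm, theta_add_one, theta_add_one, mul_neg, neg_mul, neg_div_neg_eq]
  simpa using h1.int_mul n a

/-- `δ` is well defined: any logarithms of the arguments may be used. -/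
theorem delta_e (τ a b : ℂ) :
    delta τ (e a) (e b) = 1 / (2 * Real.pi * Complex.I) * Delta τ a b := by
  have key : ∀ x : ℂ, ∃ n : ℤ,
      Complex.log (e x) / (2 * Real.pi * Complex.I) = x + n := by
    intro x
    have h0 : Complex.exp (Complex.log (e x)) = Complex.exp (2 * Real.pi * Complex.I * x) :=
      Complex.exp_log (Complex.exp_ne_zero _)
    obtain ⟨n, hn⟩ := Complex.exp_eq_exp_iff_exists_int.1 h0
    refine ⟨n, ?_⟩
    rw [hn, div_eq_iff Complex.two_pi_I_ne_zero]
    ring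
  obtain ⟨m, hm⟩ := key a
  obtain ⟨n, hn⟩ := key b
  unfold delta
  rw [hm, hn, Delta_add_int_left, Delta_comm, Delta_add_int_left, Delta_comm]

end ThetaD4

end

/-! Write `t = e x`, `h = e b`. Both sides are combinations of products `δ(e u, h) δ(e v, h)` with
the same sum `u + v = 2 * x`. Up to a factor depending only on `b`, such a product is θ(u + b) θ(v +
b) / (θ(u) θ(v)), and as functions of `b` all of these are entire with the same quasi-periods. Since
`2 * x` is not a period, a function of this type is determined by its value and derivative at `b =
0`: a double zero there allows division by θ², and the quotient is entire with multipliers `1` and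
`e(-2x)`, hence zero (`eq_zero_of_double_zero`).

It remains to compare first-order data. The sign is `-1` exactly when `k` and `l` are both even, so
a signed sum over the 4-division grid is the full sum minus twice the sum over the 2-division grid.
The values give (16 - 2·4)/8 = 1. For the derivatives, let E = θ'/θ; the distribution relation
`sum_logDeriv_thetaProd` turns the two sums into 8E(4x) and 4E(2x), and (8E(4x) - 2·4E(2x))/8 =
E(4x) + E(-2x) because E is odd.

The zeros of θ are read off from the product `thetaProd`; Liouville's theorem identifies the series
with a constant multiple of it. -/

namespace ThetaD4

open Complex Filter Topology

/-! ### Division of entire functions and Liouville's theorem on a lattice -/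

theorem differentiable_dslope {F : ℂ → ℂ} (hF : Differentiable ℂ F) (a : ℂ) :
    Differentiable ℂ (dslope F a) := by
  rw [← differentiableOn_univ]
  exact (Complex.differentiableOn_dslope univ_mem).2 hF.differentiableOn

/-- An entire function vanishing on the zeros of an entire function with only simple zeros is
divisible by it. -/
theorem exists_entire_quotient {F G : ℂ → ℂ} (hF : Differentiable ℂ F) (hG : Differentiable ℂ G)
    (hs : ∀ z, G z = 0 → deriv G z ≠ 0) (hFG : ∀ z, G z = 0 → F z = 0) :
    ∃ H : ℂ → ℂ, Differentiable ℂ H ∧ ∀ z, F z = G z * H z := by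
  classical
  refine ⟨fun z => if G z = 0 then deriv F z / deriv G z else F z / G z, fun z => ?_, fun z => ?_⟩
  · by_cases hz : G z = 0
    · have hd : dslope G z z ≠ 0 := by rw [dslope_same]; exact hs z hz
      have hev : ∀ᶠ w in 𝓝 z, dslope G z w ≠ 0 :=
        (differentiable_dslope hG z).continuous.continuousAt.eventually_ne hd
      have hdiff : DifferentiableAt ℂ (fun w => dslope F z w / dslope G z w) z :=
        (differentiable_dslope hF z z).div (differentiable_dslope hG z z) hd
      refine hdiff.congr_of_eventuallyEq ?_
      filter_upwards [hev] with w hw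
      have eF : F w = (w - z) * dslope F z w := by
        have := sub_smul_dslope F z w
        rw [hFG z hz, sub_zero] at this
        simpa using this.symm
      have eG : G w = (w - z) * dslope G z w := by
        have := sub_smul_dslope G z w
        rw [hz, sub_zero] at this
        simpa using this.symm
      by_cases hwz : w = z
      · subst hwz
        simp [hz, dslope_same]
      · have h0 : w - z ≠ 0 := sub_ne_zero.2 hwz
        rw [if_neg (by rw [eG]; exact mul_ne_zero h0 hw), eF, eG, mul_div_mul_left _ _ h0]
    · have hdiff : DifferentiableAt ℂ (fun w => F w / G w) z := (hF z).div (hG z) hz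
      refine hdiff.congr_of_eventuallyEq ?_
      filter_upwards [hG.continuous.continuousAt.eventually_ne hz] with w hw
      rw [if_neg hw]
  · by_cases hz : G z = 0
    · simp [hz, hFG z hz]
    · simp only [if_neg hz]
      field_simp

/-- Continuous functions agreeing off the zeros of an entire function with only simple zeros
agree everywhere. -/
theorem eq_of_mul_eq_mul_of_simple_zeros {G A B : ℂ → ℂ} (hG : Differentiable ℂ G)
    (hs : ∀ z, G z = 0 → deriv G z ≠ 0) (hA : Continuous A) (hB : Continuous B)
    (h : ∀ z, G z * A z = G z * B z) (z : ℂ) : A z = B z := by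
  by_cases hz : G z = 0
  · have hne : ∀ᶠ w in 𝓝[≠] z, G w ≠ 0 := by
      have := (hG z).hasDerivAt.eventually_ne (hs z hz) (c := 0)
      simpa using this
    have h1 : Tendsto A (𝓝[≠] z) (𝓝 (A z)) := hA.continuousAt.tendsto.mono_left nhdsWithin_le_nhds
    have h2 : Tendsto B (𝓝[≠] z) (𝓝 (B z)) := hB.continuousAt.tendsto.mono_left nhdsWithin_le_nhds
    refine tendsto_nhds_unique h1 (h2.congr' ?_)
    filter_upwards [hne] with w hw
    exact (mul_left_cancel₀ hw (h w)).symm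
  · exact mul_left_cancel₀ hz (h z)

/-- Real coordinates with respect to the basis `1, τ`. -/
theorem exists_real_coords {τ : ℂ} (hτ : 0 < τ.im) (z : ℂ) : ∃ r s : ℝ, z = r + s * τ := by
  refine ⟨z.re - z.im / τ.im * τ.re, z.im / τ.im, ?_⟩
  apply Complex.ext
  · simp
  · simp [hτ.ne']

/-- Carries vanishing, simplicity of zeros and norm bounds from one point to its whole lattice
coset. -/
theorem lattice_invariant_iff {τ : ℂ} {Q : ℂ → Prop} (h1 : ∀ z, Q z ↔ Q (z + 1))
    (h2 : ∀ z, Q z ↔ Q (z + τ)) (z : ℂ) (m n : ℤ) : Q z ↔ Q (z + m + n * τ) := by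
  have a : ∀ m : ℤ, ∀ z, Q z ↔ Q (z + m) := by
    intro m
    induction m using Int.induction_on with
    | zero => simp
    | succ k ih =>
      intro z
      rw [ih z, h1]
      push_cast
      rw [add_assoc]
    | pred k ih =>
      intro z
      rw [ih z, h1 (z + ((-(k : ℤ) - 1 : ℤ) : ℂ))]
      push_cast
      ring_nf
  have b : ∀ n : ℤ, ∀ z, Q z ↔ Q (z + n * τ) := by
    intro n
    induction n using Int.induction_on with
    | zero => simp
    | succ k ih =>
      intro z
      rw [ih z, h2]
      push_cast
      ring_nf
    | pred k ih =>
      intro z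
      rw [ih z, h2 (z + ((-(k : ℤ) - 1 : ℤ) : ℂ) * τ)]
      push_cast
      ring_nf
  rw [a m z, b n (z + m)]

/-- Liouville's theorem for entire functions with doubly periodic absolute value. -/
theorem eq_const_of_norm_doubly_periodic {τ : ℂ} (hτ : 0 < τ.im) {f : ℂ → ℂ}
    (hf : Differentiable ℂ f) (h1 : ∀ z, ‖f (z + 1)‖ = ‖f z‖) (h2 : ∀ z, ‖f (z + τ)‖ = ‖f z‖)
    (z w : ℂ) : f z = f w := by
  refine hf.apply_eq_apply_of_bounded ?_ z w
  let g : ℝ × ℝ → ℂ := fun p => f (p.1 + p.2 * τ)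
  have hg : Continuous g := by
    have := hf.continuous
    fun_prop
  have hc : IsCompact (g '' (Set.Icc (0 : ℝ) 1 ×ˢ Set.Icc (0 : ℝ) 1)) :=
    (isCompact_Icc.prod isCompact_Icc).image hg
  obtain ⟨C, hC⟩ := isBounded_iff_forall_norm_le.1 hc.isBounded
  refine isBounded_iff_forall_norm_le.2 ⟨C, ?_⟩
  rintro _ ⟨z, rfl⟩
  obtain ⟨r, s, rfl⟩ := exists_real_coords hτ z
  have key : ‖f (Int.fract r + Int.fract s * τ)‖ ≤ C :=
    hC _ ⟨(Int.fract r, Int.fract s), ⟨⟨Int.fract_nonneg r, (Int.fract_lt_one r).le⟩,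
      ⟨Int.fract_nonneg s, (Int.fract_lt_one s).le⟩⟩, rfl⟩
  have := (lattice_invariant_iff (Q := fun z => ‖f z‖ ≤ C) (τ := τ)
    (fun z => by rw [h1]) (fun z => by rw [h2]) (Int.fract r + Int.fract s * τ)
    ⌊r⌋ ⌊s⌋).1 key
  have e1 : (r : ℂ) = Int.fract r + ⌊r⌋ := by
    rw [← Complex.ofReal_intCast, ← Complex.ofReal_add, Int.fract_add_floor]
  have e2 : (s : ℂ) = Int.fract s + ⌊s⌋ := by
    rw [← Complex.ofReal_intCast, ← Complex.ofReal_add, Int.fract_add_floor]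
  have e3 : (r + s * τ : ℂ) = Int.fract r + Int.fract s * τ + ⌊r⌋ + ⌊s⌋ * τ := by
    linear_combination e1 + τ * e2
  rwa [← e3] at this

/-! ### The exponential `e` and entire functions with constant multipliers -/

theorem e_add (x y : ℂ) : e (x + y) = e x * e y := by
  unfold e
  rw [mul_add, Complex.exp_add]

theorem e_ne_zero (x : ℂ) : e x ≠ 0 := Complex.exp_ne_zero _

theorem e_zero : e 0 = 1 := by simp [e]

theorem e_neg (x : ℂ) : e (-x) = (e x)⁻¹ := by
  unfold e
  rw [mul_neg, Complex.exp_neg]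

theorem e_sub (x y : ℂ) : e (x - y) = e x / e y := by
  rw [sub_eq_add_neg, e_add, e_neg, div_eq_mul_inv]

theorem e_one : e 1 = 1 := by simp [e, Complex.exp_two_pi_mul_I]

theorem e_half : e (1 / 2) = -1 := by
  unfold e
  rw [← Complex.exp_pi_mul_I]
  congr 1
  ring

theorem e_int_mul (n : ℤ) (x : ℂ) : e (n * x) = e x ^ n := by
  unfold e
  rw [← Complex.exp_int_mul]
  congr 1
  ring

theorem differentiable_e : Differentiable ℂ e := by
  unfold e
  fun_prop

theorem hasDerivAt_e (x : ℂ) : HasDerivAt e (2 * Real.pi * I * e x) x := by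
  have : HasDerivAt (fun x : ℂ => 2 * Real.pi * I * x) (2 * Real.pi * I) x := by
    simpa using (hasDerivAt_id x).const_mul (2 * Real.pi * I)
  exact this.cexp.congr_deriv (mul_comm _ _)

theorem e_eq_one_iff (x : ℂ) : e x = 1 ↔ ∃ n : ℤ, x = n := by
  unfold e
  rw [Complex.exp_eq_one_iff]
  refine exists_congr fun n => ?_
  rw [mul_comm, mul_left_inj' Complex.two_pi_I_ne_zero]

theorem norm_e_ofReal (r : ℝ) : ‖e r‖ = 1 := by
  unfold e
  have : (2 * Real.pi * I * r : ℂ) = ((2 * Real.pi * r : ℝ) : ℂ) * I := by push_cast; ring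
  rw [this, Complex.norm_exp_ofReal_mul_I]

theorem norm_e_lt_one {τ : ℂ} (hτ : 0 < τ.im) : ‖e τ‖ < 1 := by
  unfold e
  rw [Complex.norm_exp, Real.exp_lt_one_iff]
  have : (2 * Real.pi * I * τ : ℂ).re = -(2 * Real.pi * τ.im) := by simp
  rw [this]
  have := Real.pi_pos
  have : 0 < 2 * Real.pi * τ.im := by positivity
  linarith

theorem exists_e_eq {A : ℂ} (hA : A ≠ 0) : ∃ a, e a = A := by
  refine ⟨Complex.log A / (2 * Real.pi * I), ?_⟩
  unfold e
  rw [mul_div_cancel₀ _ Complex.two_pi_I_ne_zero, Complex.exp_log hA]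

/-- An entire function that is periodic with period `1` and is multiplied by `e(-w)` under
translation by `τ` vanishes unless `w` is a period. -/
theorem eq_zero_of_quasiperiodic {τ : ℂ} (hτ : 0 < τ.im) {w : ℂ} {f : ℂ → ℂ}
    (hw : ∀ m n : ℤ, w ≠ m + n * τ)
    (hf : Differentiable ℂ f) (h1 : ∀ z, f (z + 1) = f z) (h2 : ∀ z, f (z + τ) = e (-w) * f z)
    (z : ℂ) : f z = 0 := by
  obtain ⟨r, s, rfl⟩ := exists_real_coords hτ w
  -- With `w = r + s * τ`, the factor `e (s * z)` makes both multipliers unimodular: they become `e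
  -- s` and `e (-r)` with `r`, `s` real.
  have hd : Differentiable ℂ fun z => f z * e (s * z) :=
    hf.mul (differentiable_e.comp (by fun_prop))
  have hconst := eq_const_of_norm_doubly_periodic hτ hd
    (fun z => by
      rw [h1, mul_add, e_add, norm_mul, norm_mul, norm_mul, mul_one, norm_e_ofReal, mul_one])
    (fun z => by
      have : e (-(r + s * τ)) * f z * e (s * (z + τ)) = e ((-r : ℝ)) * (f z * e (s * z)) := by
        have hh : e (-(r + s * τ)) * e (s * (z + τ)) = e ((-r : ℝ)) * e (s * z) := by
          rw [← e_add, ← e_add]; congr 1; push_cast; ring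
        linear_combination f z * hh
      rw [h2, this, norm_mul, norm_e_ofReal, one_mul])
  have hform : ∀ z, f z = f 0 * e (-(s * z)) := by
    intro z
    have := hconst z 0
    simp only [mul_zero, e_zero, mul_one] at this
    rw [e_neg, ← this, mul_assoc, mul_inv_cancel₀ (e_ne_zero _), mul_one]
  -- If `f` is a nonzero multiple of `e (-(s * z))`, its two multipliers force `e s = 1` and `e r =
  -- 1`, so `w` is a period.
  by_contra hz
  have h0 : f 0 ≠ 0 := fun h => hz (by rw [hform z, h, zero_mul])
  have hs : e s = 1 := by
    have a := h1 0
    rw [zero_add, hform 1, mul_one, e_neg] at a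
    have b : (e s)⁻¹ = 1 := mul_left_cancel₀ h0 (by rw [a, mul_one])
    rwa [inv_eq_one] at b
  have hr : e r = 1 := by
    have a := h2 0
    rw [zero_add, hform τ, mul_comm] at a
    have b := mul_right_cancel₀ h0 a
    rw [neg_add, e_add, e_neg (r : ℂ)] at b
    have c : (e r)⁻¹ = 1 := mul_right_cancel₀ (e_ne_zero (-(s * τ))) (by rw [← b, one_mul])
    rwa [inv_eq_one] at c
  obtain ⟨m, hm⟩ := (e_eq_one_iff _).1 hr
  obtain ⟨n, hn⟩ := (e_eq_one_iff _).1 hs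
  exact hw m n (by rw [hm, hn])

/-! ### The theta product: quasi-periods and simple zeros -/

/-- The infinite product `∏ (1 - qⁿ z)` over `n ≥ 0`. -/
noncomputable def qProd (q z : ℂ) : ℂ := ∏' n : ℕ, (1 + -(q ^ n * z))

theorem summable_norm_qProd_term {q : ℂ} (hq : ‖q‖ < 1) (z : ℂ) :
    Summable fun n : ℕ => ‖-(q ^ n * z)‖ := by
  simp only [norm_neg, norm_mul, norm_pow]
  exact (summable_geometric_of_lt_one (norm_nonneg _) hq).mul_right _

theorem qProd_eq_mul {q : ℂ} (hq : ‖q‖ < 1) (z : ℂ) :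
    qProd q z = (1 - z) * qProd q (q * z) := by
  have h : (fun n : ℕ => 1 + -(q ^ n * (q * z))) = fun n : ℕ => 1 + -(q ^ (n + 1) * z) := by
    funext n
    ring
  unfold qProd
  rw [h, tprod_eq_zero_mul']
  · simp [sub_eq_add_neg]
  · rw [← h]
    exact multipliable_one_add_of_summable (summable_norm_qProd_term hq _)

theorem qProd_ne_zero {q : ℂ} (hq : ‖q‖ < 1) {z : ℂ} (hz : ∀ n : ℕ, q ^ n * z ≠ 1) :
    qProd q z ≠ 0 := by
  refine tprod_one_add_ne_zero_of_summable (fun n h => hz n ?_) (summable_norm_qProd_term hq z)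
  linear_combination -h

/-- On each ball a geometric series dominates the terms, so the product converges locally uniformly.
-/
theorem differentiable_qProd {q : ℂ} (hq : ‖q‖ < 1) : Differentiable ℂ (qProd q) := by
  intro z
  have hK : IsOpen (Metric.ball (0 : ℂ) (‖z‖ + 1)) := Metric.isOpen_ball
  have hu : Summable fun n : ℕ => ‖q‖ ^ n * (‖z‖ + 1) :=
    (summable_geometric_of_lt_one (norm_nonneg _) hq).mul_right _
  have H := hu.hasProdLocallyUniformlyOn_nat_one_add (f := fun (n : ℕ) (x : ℂ) => -(q ^ n * x)) hK
    (Eventually.of_forall fun n x hx => by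
      rw [norm_neg, norm_mul, norm_pow]
      have : ‖x‖ ≤ ‖z‖ + 1 := by
        rw [mem_ball_zero_iff] at hx
        exact hx.le
      gcongr) (fun n => by fun_prop)
  have D : DifferentiableOn ℂ (qProd q) (Metric.ball (0 : ℂ) (‖z‖ + 1)) :=
    H.differentiableOn (Eventually.of_forall fun s => by
      simpa [Finset.prod_fn] using
        DifferentiableOn.finsetProd (fun _ _ => by fun_prop)) hK
  exact D.differentiableAt (hK.mem_nhds (by simp))

/-- The Jacobi theta function up to a constant factor, as an infinite product. -/
noncomputable def thetaProd (τ u : ℂ) : ℂ :=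
  e (-(u / 2)) * qProd (e τ) (e u) * qProd (e τ) (e τ * e (-u))

variable {τ : ℂ}

theorem thetaProd_eq (hτ : 0 < τ.im) (u : ℂ) : thetaProd τ u =
    e (-(u / 2)) * (1 - e u) * (qProd (e τ) (e τ * e u) * qProd (e τ) (e τ * e (-u))) := by
  unfold thetaProd
  rw [qProd_eq_mul (norm_e_lt_one hτ) (e u)]
  ring

theorem differentiable_thetaProd (hτ : 0 < τ.im) : Differentiable ℂ (thetaProd τ) := by
  have h1 := differentiable_qProd (norm_e_lt_one hτ)
  have h2 := differentiable_e
  unfold thetaProd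
  fun_prop

theorem e_add_one (u : ℂ) : e (u + 1) = e u := by rw [e_add, e_one, mul_one]

theorem thetaProd_add_one (u : ℂ) : thetaProd τ (u + 1) = -thetaProd τ u := by
  have h1 : e (-((u + 1) / 2)) = -e (-(u / 2)) := by
    rw [show -((u + 1) / 2) = -(u / 2) + -(1 / 2) by ring, e_add, e_neg (1 / 2), e_half]
    norm_num
  have h2 : e (-(u + 1)) = e (-u) := by rw [e_neg, e_add_one, e_neg]
  unfold thetaProd
  rw [h1, h2, e_add_one]
  ring

theorem thetaProd_neg (hτ : 0 < τ.im) (u : ℂ) : thetaProd τ (-u) = -thetaProd τ u := by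
  rw [thetaProd_eq hτ, thetaProd_eq hτ, neg_neg]
  have h : e (-(-u / 2)) * (1 - e (-u)) = -(e (-(u / 2)) * (1 - e u)) := by
    have h1 : e (-(-u / 2)) = e (-(u / 2)) * e u := by rw [← e_add]; congr 1; ring
    have h2 : e u * e (-u) = 1 := by rw [← e_add, add_neg_cancel, e_zero]
    rw [h1]
    linear_combination -e (-(u / 2)) * h2
  rw [h]
  ring

/-- The translation removes the factor `1 - e u` from one product and adds `1 - e (-u)` to the
other; their ratio is `-e (-u)`. -/
theorem thetaProd_add_tau (hτ : 0 < τ.im) (u : ℂ) :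
    thetaProd τ (u + τ) = -e (-u - τ / 2) * thetaProd τ u := by
  rw [thetaProd_eq hτ u]
  unfold thetaProd
  have h1 : e (u + τ) = e τ * e u := by rw [add_comm, e_add]
  have h2 : e τ * e (-(u + τ)) = e (-u) := by rw [← e_add]; congr 1; ring
  have h3 : e (-((u + τ) / 2)) = e (-u - τ / 2) * e (-(u / 2)) * e u := by
    rw [← e_add, ← e_add]; congr 1; ring
  have h4 : e u * e (-u) = 1 := by rw [← e_add, add_neg_cancel, e_zero]
  rw [h1, h2, h3, qProd_eq_mul (norm_e_lt_one hτ) (e (-u))]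
  linear_combination (-e (-u - τ / 2) * e (-(u / 2)) * qProd (e τ) (e τ * e u) *
    qProd (e τ) (e τ * e (-u))) * h4

theorem thetaProd_zero (hτ : 0 < τ.im) : thetaProd τ 0 = 0 := by
  rw [thetaProd_eq hτ, e_zero]
  simp

theorem e_ne_e_zpow {u : ℂ} (hu : ∀ m n : ℤ, u ≠ m + n * τ) (n : ℤ) : e u ≠ e τ ^ n := by
  intro h
  rw [← e_int_mul] at h
  have : e (u - n * τ) = 1 := by rw [e_sub, h, div_self (e_ne_zero _)]
  obtain ⟨m, hm⟩ := (e_eq_one_iff _).1 this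
  exact hu m n (by linear_combination hm)

theorem thetaProd_ne_zero (hτ : 0 < τ.im) {u : ℂ} (hu : ∀ m n : ℤ, u ≠ m + n * τ) :
    thetaProd τ u ≠ 0 := by
  refine mul_ne_zero (mul_ne_zero (e_ne_zero _) ?_) ?_
  · refine qProd_ne_zero (norm_e_lt_one hτ) fun n h => e_ne_e_zpow hu (-n) ?_
    rw [zpow_neg, zpow_natCast]
    exact eq_inv_of_mul_eq_one_left (by rw [mul_comm, h])
  · refine qProd_ne_zero (norm_e_lt_one hτ) fun n h => e_ne_e_zpow hu (n + 1) ?_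
    rw [e_neg, ← mul_assoc, ← pow_succ, mul_inv_eq_one₀ (e_ne_zero _)] at h
    rw [← h]
    norm_cast

theorem qProd_e_self_ne_zero (hτ : 0 < τ.im) : qProd (e τ) (e τ) ≠ 0 := by
  refine qProd_ne_zero (norm_e_lt_one hτ) fun n h => ?_
  rw [← pow_succ] at h
  have := pow_lt_one₀ (norm_nonneg _) (norm_e_lt_one hτ) (Nat.succ_ne_zero n)
  rw [← norm_pow, Nat.succ_eq_add_one, h, norm_one] at this
  exact lt_irrefl _ this

theorem deriv_thetaProd_zero (hτ : 0 < τ.im) : deriv (thetaProd τ) 0 ≠ 0 := by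
  have h1 := differentiable_qProd (norm_e_lt_one hτ)
  have h2 := differentiable_e
  let R : ℂ → ℂ := fun u => e (-(u / 2)) *
    (qProd (e τ) (e τ * e u) * qProd (e τ) (e τ * e (-u)))
  have hR : Differentiable ℂ R := by
    simp only [R]
    fun_prop
  have hP : thetaProd τ = fun u => (1 - e u) * R u := by
    funext u
    rw [thetaProd_eq hτ]
    simp only [R]
    ring
  have hd : HasDerivAt (fun u => (1 - e u) * R u)
      (-(2 * Real.pi * I * e 0) * R 0 + (1 - e 0) * deriv R 0) 0 :=
    ((hasDerivAt_e 0).const_sub 1).mul (hR 0).hasDerivAt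
  rw [hP, hd.deriv]
  simp only [R, e_zero, neg_zero, zero_div, mul_one, sub_self, zero_mul, add_zero, one_mul]
  exact mul_ne_zero (neg_ne_zero.2 Complex.two_pi_I_ne_zero)
    (mul_ne_zero (qProd_e_self_ne_zero hτ) (qProd_e_self_ne_zero hτ))

/-- At a zero of `f`, differentiating `m * f` leaves only `m * f'`, and `m` has no zeros. -/
theorem simple_zero_transfer {f m : ℂ → ℂ} {a : ℂ} (hf : Differentiable ℂ f)
    (hm : Differentiable ℂ m) (hm0 : ∀ z, m z ≠ 0) (h : ∀ z, f (z + a) = m z * f z) (z : ℂ) :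
    (f z = 0 ∧ deriv f z ≠ 0) ↔ (f (z + a) = 0 ∧ deriv f (z + a) ≠ 0) := by
  have hz : f (z + a) = 0 ↔ f z = 0 := by simp [h, hm0]
  rw [hz]
  refine and_congr_right fun h0 => ?_
  have hd : deriv f (z + a) = m z * deriv f z := by
    rw [← deriv_comp_add_const, show (fun x => f (x + a)) = fun x => m x * f x from funext h]
    rw [deriv_fun_mul (hm z) (hf z), h0]
    simp
  rw [hd]
  simp [hm0]

theorem thetaProd_simple_zero (hτ : 0 < τ.im) (u : ℂ) (hu : thetaProd τ u = 0) :
    deriv (thetaProd τ) u ≠ 0 := by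
  have hex : ∃ m n : ℤ, u = m + n * τ := by
    by_contra! hne
    exact thetaProd_ne_zero hτ hne hu
  obtain ⟨m, n, rfl⟩ := hex
  have hd := differentiable_thetaProd hτ
  have key := (lattice_invariant_iff (τ := τ)
    (Q := fun z => thetaProd τ z = 0 ∧ deriv (thetaProd τ) z ≠ 0)
    (simple_zero_transfer (m := fun _ => -1) hd (by fun_prop) (by simp)
      (fun z => by rw [thetaProd_add_one]; ring))
    (simple_zero_transfer (m := fun z => -e (-z - τ / 2)) hd
      ((differentiable_e.comp (by fun_prop)).neg) (fun z => neg_ne_zero.2 (e_ne_zero _))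
      (thetaProd_add_tau hτ)) 0 m n).1 ⟨thetaProd_zero hτ, deriv_thetaProd_zero hτ⟩
  rw [zero_add] at key
  exact key.2

/-- An entire function with a zero at the origin and compatible quasi-periods is divisible by
the theta product, and the quotient is quasi-periodic. -/
theorem exists_thetaProd_quotient (hτ : 0 < τ.im) {F m₁ m₂ : ℂ → ℂ} (hF : Differentiable ℂ F)
    (hF0 : F 0 = 0) (hm₁ : ∀ z, m₁ z ≠ 0) (hm₂ : ∀ z, m₂ z ≠ 0)
    (c₁ : Continuous m₁) (c₂ : Continuous m₂)
    (h1 : ∀ z, F (z + 1) = -m₁ z * F z)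
    (h2 : ∀ z, F (z + τ) = -e (-z - τ / 2) * m₂ z * F z) :
    ∃ H : ℂ → ℂ, Differentiable ℂ H ∧ (∀ z, F z = thetaProd τ z * H z) ∧
      (∀ z, H (z + 1) = m₁ z * H z) ∧ ∀ z, H (z + τ) = m₂ z * H z := by
  have hd := differentiable_thetaProd hτ
  have hs := thetaProd_simple_zero hτ
  obtain ⟨H, hH, hFH⟩ := exists_entire_quotient hF hd hs fun u hu => by
    have hex : ∃ m n : ℤ, u = m + n * τ := by
      by_contra! hne
      exact thetaProd_ne_zero hτ hne hu
    obtain ⟨m, n, rfl⟩ := hex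
    have key := (lattice_invariant_iff (τ := τ) (Q := fun z => F z = 0)
      (fun z => by simp [h1, hm₁]) (fun z => by simp [h2, hm₂, e_ne_zero]) 0 m n).1 hF0
    rwa [zero_add] at key
  refine ⟨H, hH, hFH, ?_, ?_⟩
  -- The multipliers of `H` follow by cancelling `thetaProd` off its zeros; continuity covers the
  -- zeros.
  · refine eq_of_mul_eq_mul_of_simple_zeros (A := fun z => H (z + 1)) hd hs
      (by have := hH.continuous; fun_prop) (c₁.mul hH.continuous) fun z => ?_
    have := h1 z
    rw [hFH, hFH, thetaProd_add_one] at this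
    linear_combination -this
  · refine eq_of_mul_eq_mul_of_simple_zeros (A := fun z => H (z + τ)) hd hs
      (by have := hH.continuous; fun_prop) (c₂.mul hH.continuous) fun z => ?_
    have := h2 z
    rw [hFH, hFH, thetaProd_add_tau hτ] at this
    refine mul_left_cancel₀ (neg_ne_zero.2 (e_ne_zero (-z - τ / 2))) ?_
    linear_combination this

/-! ### Comparison of the theta series with the product -/

/-- Expanding `(n + 1/2)^2` gives the shift `τ / 2` and the constant `τ / 8`; the sign `(-1)^n`
gives the shift `1 / 2`. -/
theorem theta_eq_jacobiTheta₂ (τ u : ℂ) :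
    theta τ u = 1 / I * (e (τ / 8 + u / 2) * jacobiTheta₂ (u + 1 / 2 + τ / 2) τ) := by
  unfold theta jacobiTheta₂
  rw [← tsum_mul_left (a := e (τ / 8 + u / 2))]
  congr 1
  refine tsum_congr fun n => ?_
  have h : ((-1 : ℂ)) ^ n = Complex.exp (n * (Real.pi * I)) := by
    rw [Complex.exp_int_mul, Complex.exp_pi_mul_I]
  unfold jacobiTheta₂_term e
  rw [h, ← Complex.exp_add, ← Complex.exp_add, ← Complex.exp_add]
  congr 1
  ring

theorem differentiable_theta (hτ : 0 < τ.im) : Differentiable ℂ (theta τ) := by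
  have h : Differentiable ℂ fun z => jacobiTheta₂ z τ :=
    fun z => differentiableAt_jacobiTheta₂_fst z hτ
  have h2 := differentiable_e
  rw [show theta τ = _ from funext (theta_eq_jacobiTheta₂ τ)]
  exact (differentiable_const _).mul ((h2.comp (by fun_prop)).mul (h.comp (by fun_prop)))

theorem theta_add_tau (τ u : ℂ) : theta τ (u + τ) = -e (-u - τ / 2) * theta τ u := by
  rw [theta_eq_jacobiTheta₂, theta_eq_jacobiTheta₂,
    show u + τ + 1 / 2 + τ / 2 = (u + 1 / 2 + τ / 2) + τ by ring, jacobiTheta₂_add_left']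
  have h : e (τ / 8 + (u + τ) / 2) * Complex.exp (-Real.pi * I * (τ + 2 * (u + 1 / 2 + τ / 2))) =
      -e (-u - τ / 2) * e (τ / 8 + u / 2) := by
    have : Complex.exp (-Real.pi * I * (τ + 2 * (u + 1 / 2 + τ / 2))) = e (-u - τ + 1 / 2) := by
      rw [show -u - τ + 1 / 2 = (-u - τ - 1 / 2) + 1 by ring, e_add_one]
      unfold e
      congr 1
      ring
    have h' : -e (-u - τ / 2) = e (-u - τ / 2 + 1 / 2) := by rw [e_add, e_half]; ring
    rw [this, h', ← e_add, ← e_add]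
    congr 1
    ring
  linear_combination (1 / I * jacobiTheta₂ (u + 1 / 2 + τ / 2) τ) * h

/-- The points `1/2 ± τ/2` differ by `τ`, which gives opposite values, and are exchanged by negation
modulo `1`, which gives equal values. -/
theorem theta_zero (τ : ℂ) : theta τ 0 = 0 := by
  have h1 : jacobiTheta₂ (1 / 2 + τ / 2) τ = -jacobiTheta₂ (1 / 2 - τ / 2) τ := by
    have := jacobiTheta₂_add_left' (1 / 2 - τ / 2) τ
    rw [show 1 / 2 - τ / 2 + τ = 1 / 2 + τ / 2 by ring,
      show -(Real.pi : ℂ) * I * (τ + 2 * (1 / 2 - τ / 2)) = -(Real.pi * I) by ring,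
      Complex.exp_neg, Complex.exp_pi_mul_I] at this
    rw [this]
    norm_num
  have h2 : jacobiTheta₂ (1 / 2 - τ / 2) τ = jacobiTheta₂ (1 / 2 + τ / 2) τ := by
    rw [← jacobiTheta₂_neg_left (1 / 2 + τ / 2), ← jacobiTheta₂_add_left (-(1 / 2 + τ / 2))]
    ring_nf
  have h3 : jacobiTheta₂ (1 / 2 + τ / 2) τ = 0 := by
    rw [h2] at h1
    linear_combination h1 / 2
  rw [theta_eq_jacobiTheta₂, zero_add, h3]
  simp

theorem exists_theta_eq_mul_thetaProd (hτ : 0 < τ.im) :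
    ∃ C : ℂ, ∀ u, theta τ u = C * thetaProd τ u := by
  obtain ⟨H, hH, hFH, h1, h2⟩ := exists_thetaProd_quotient (m₁ := fun _ => 1) (m₂ := fun _ => 1) hτ
    (differentiable_theta hτ) (theta_zero τ) (by simp) (by simp) (by fun_prop) (by fun_prop)
    (fun z => by rw [theta_add_one]; ring) (fun z => by rw [theta_add_tau]; ring)
  refine ⟨H 0, fun u => ?_⟩
  rw [hFH, eq_const_of_norm_doubly_periodic hτ hH (fun z => by rw [h1, one_mul])
    (fun z => by rw [h2, one_mul]) u 0, mul_comm]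

/-! ### The distribution relation for the logarithmic derivative -/

theorem ne_lattice_neg {y : ℂ} (hy : ∀ m n : ℤ, y ≠ m + n * τ) (m n : ℤ) : -y ≠ m + n * τ := by
  intro h
  refine hy (-m) (-n) ?_
  push_cast
  linear_combination -h

theorem logDeriv_comp_neg {f : ℂ → ℂ} (x : ℂ) :
    logDeriv (fun z => f (-z)) x = -logDeriv f (-x) := by
  rw [logDeriv_apply, logDeriv_apply, deriv_comp_neg, neg_div]

theorem logDeriv_thetaProd_neg (hτ : 0 < τ.im) (u : ℂ) :
    logDeriv (thetaProd τ) (-u) = -logDeriv (thetaProd τ) u := by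
  have h : (fun z => thetaProd τ (-z)) = fun z => (-1) * thetaProd τ z := by
    funext z
    rw [thetaProd_neg hτ, neg_one_mul]
  have h2 := logDeriv_comp_neg (f := thetaProd τ) u
  rw [h, logDeriv_const_mul _ _ (by norm_num)] at h2
  rw [h2, neg_neg]

/-- The product of the theta products at the `N`-division points of `y`, up to translation. -/
noncomputable def divisionProd (τ : ℂ) (N : ℕ) (y : ℂ) : ℂ :=
  ∏ k ∈ Finset.range N, ∏ l ∈ Finset.range N, thetaProd τ ((y + k - l * τ) / N)

theorem differentiable_divisionProd (hτ : 0 < τ.im) (N : ℕ) :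
    Differentiable ℂ (divisionProd τ N) := by
  have h := differentiable_thetaProd hτ
  unfold divisionProd
  fun_prop

theorem divisionProd_zero (hτ : 0 < τ.im) (N : ℕ) : divisionProd τ (N + 1) 0 = 0 := by
  refine Finset.prod_eq_zero (i := 0) (by simp) (Finset.prod_eq_zero (i := 0) (by simp) ?_)
  simp [thetaProd_zero hτ]

theorem division_point_ne {N : ℕ} {y : ℂ} (hy : ∀ m n : ℤ, y ≠ m + n * τ) (k l : ℕ) (m n : ℤ) :
    (y + k - l * τ) / (N + 1 : ℕ) ≠ m + n * τ := by
  intro h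
  have hN : ((N + 1 : ℕ) : ℂ) ≠ 0 := Nat.cast_ne_zero.2 (Nat.succ_ne_zero N)
  rw [div_eq_iff hN] at h
  refine hy ((N + 1 : ℕ) * m - k) ((N + 1 : ℕ) * n + l) ?_
  push_cast at h ⊢
  linear_combination h

theorem divisionProd_ne_zero (hτ : 0 < τ.im) (N : ℕ) {y : ℂ} (hy : ∀ m n : ℤ, y ≠ m + n * τ) :
    divisionProd τ (N + 1) y ≠ 0 :=
  Finset.prod_ne_zero_iff.2 fun _ _ => Finset.prod_ne_zero_iff.2 fun _ _ =>
    thetaProd_ne_zero hτ (division_point_ne hy _ _)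

/-- The shift moves `k` to `k + 1`; only the last row wraps around, by a full period `1`, at the
cost of one sign per factor. -/
theorem divisionProd_add_one (N : ℕ) (y : ℂ) :
    divisionProd τ (N + 1) (y + 1) = (-1) ^ (N + 1) * divisionProd τ (N + 1) y := by
  unfold divisionProd
  have hN : ((N + 1 : ℕ) : ℂ) ≠ 0 := Nat.cast_ne_zero.2 (Nat.succ_ne_zero N)
  rw [Finset.prod_range_succ]
  conv_rhs => rw [Finset.prod_range_succ']
  have h1 : ∀ k ∈ Finset.range N, ∏ l ∈ Finset.range (N + 1),
      thetaProd τ ((y + 1 + (k : ℕ) - l * τ) / (N + 1 : ℕ)) = ∏ l ∈ Finset.range (N + 1),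
      thetaProd τ ((y + (k + 1 : ℕ) - l * τ) / (N + 1 : ℕ)) := fun k _ =>
    Finset.prod_congr rfl fun l _ => by
      congr 2
      push_cast
      ring
  have h2 : ∏ l ∈ Finset.range (N + 1), thetaProd τ ((y + 1 + (N : ℕ) - l * τ) / (N + 1 : ℕ)) =
      (-1) ^ (N + 1) * ∏ l ∈ Finset.range (N + 1),
        thetaProd τ ((y + (0 : ℕ) - l * τ) / (N + 1 : ℕ)) := by
    conv_rhs => rw [← Finset.card_range (N + 1), ← Finset.prod_const, Finset.card_range]
    rw [← Finset.prod_mul_distrib]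
    refine Finset.prod_congr rfl fun l _ => ?_
    rw [neg_one_mul, ← thetaProd_add_one]
    congr 1
    field_simp
    push_cast
    ring
  rw [Finset.prod_congr rfl h1, h2]
  ring

theorem exists_divisionProd_add_tau (hτ : 0 < τ.im) (N : ℕ) :
    ∃ c : ℂ, c ≠ 0 ∧ ∀ y, divisionProd τ (N + 1) (y + τ) =
      c * e (-y) * divisionProd τ (N + 1) y := by
  have hN : ((N + 1 : ℕ) : ℂ) ≠ 0 := Nat.cast_ne_zero.2 (Nat.succ_ne_zero N)
  -- One factor wraps around for each `k`. Its multiplier splits into a constant, collected in the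
  -- witness, and `e (-(y / (N + 1)))`; the latter multiply to `e (-y)`.
  refine ⟨∏ k ∈ Finset.range (N + 1), -e (-((k - N * τ) / (N + 1 : ℕ)) - τ / 2),
    Finset.prod_ne_zero_iff.2 fun _ _ => neg_ne_zero.2 (e_ne_zero _), fun y => ?_⟩
  have he : e (-y) = ∏ k ∈ Finset.range (N + 1), e (-(y / (N + 1 : ℕ))) := by
    rw [Finset.prod_const, Finset.card_range, ← zpow_natCast, ← e_int_mul]
    congr 1
    rw [Int.cast_natCast]
    field_simp
  unfold divisionProd
  rw [he, ← Finset.prod_mul_distrib, ← Finset.prod_mul_distrib]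
  refine Finset.prod_congr rfl fun k _ => ?_
  rw [Finset.prod_range_succ' (n := N), Finset.prod_range_succ (n := N)]
  have h1 : ∀ l ∈ Finset.range N,
      thetaProd τ ((y + τ + k - (l + 1 : ℕ) * τ) / (N + 1 : ℕ)) =
      thetaProd τ ((y + k - l * τ) / (N + 1 : ℕ)) := fun l _ => by
    congr 2
    push_cast
    ring
  have h2 : thetaProd τ ((y + τ + k - (0 : ℕ) * τ) / (N + 1 : ℕ)) =
      -e (-((k - N * τ) / (N + 1 : ℕ)) - τ / 2) * e (-(y / (N + 1 : ℕ))) *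
        thetaProd τ ((y + k - N * τ) / (N + 1 : ℕ)) := by
    have h3 : (y + τ + k - (0 : ℕ) * τ) / (N + 1 : ℕ) = (y + k - N * τ) / (N + 1 : ℕ) + τ := by
      field_simp
      push_cast
      ring
    rw [h3, thetaProd_add_tau hτ, neg_mul (e (-((k - N * τ) / (N + 1 : ℕ)) - τ / 2)), ← e_add,
      show -((y + k - N * τ) / (N + 1 : ℕ)) - τ / 2 =
        -((k - N * τ) / (N + 1 : ℕ)) - τ / 2 + -(y / (N + 1 : ℕ)) by ring, neg_mul]
  rw [Finset.prod_congr rfl h1, h2]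
  ring

theorem logDeriv_divisionProd (hτ : 0 < τ.im) (N : ℕ) {y : ℂ} (hy : ∀ m n : ℤ, y ≠ m + n * τ) :
    logDeriv (divisionProd τ (N + 1)) y =
      (∑ k ∈ Finset.range (N + 1), ∑ l ∈ Finset.range (N + 1),
        logDeriv (thetaProd τ) ((y + k - l * τ) / (N + 1 : ℕ))) / (N + 1 : ℕ) := by
  have hd := differentiable_thetaProd hτ
  have hne : ∀ k l : ℕ, thetaProd τ ((y + k - l * τ) / (N + 1 : ℕ)) ≠ 0 := fun k l =>
    thetaProd_ne_zero hτ (division_point_ne hy k l)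
  unfold divisionProd
  rw [logDeriv_prod (fun k _ => Finset.prod_ne_zero_iff.2 fun l _ => hne k l)
    (fun k _ => by fun_prop), Finset.sum_div]
  refine Finset.sum_congr rfl fun k _ => ?_
  rw [logDeriv_prod (fun l _ => hne k l) (fun l _ => by fun_prop), Finset.sum_div]
  refine Finset.sum_congr rfl fun l _ => ?_
  have hg : HasDerivAt (fun z : ℂ => (z + k - l * τ) / (N + 1 : ℕ)) (1 / (N + 1 : ℕ)) y :=
    (((hasDerivAt_id y).add_const _).sub_const _).div_const _
  have := logDeriv_comp (f := thetaProd τ) (x := y) (hd _) hg.differentiableAt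
  rw [hg.deriv] at this
  rw [← mul_one_div]
  exact this

/-- Distribution relation for the logarithmic derivative of the theta product. -/
theorem sum_logDeriv_thetaProd (hτ : 0 < τ.im) (N : ℕ) {y : ℂ}
    (hy : ∀ m n : ℤ, y ≠ m + n * τ) :
    ∑ k ∈ Finset.range (N + 1), ∑ l ∈ Finset.range (N + 1),
      (logDeriv (thetaProd τ) ((y + k - l * τ) / (N + 1 : ℕ)) +
        logDeriv (thetaProd τ) ((y - k + l * τ) / (N + 1 : ℕ))) =
      2 * (N + 1 : ℕ) * logDeriv (thetaProd τ) y := by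
  have hN : ((N + 1 : ℕ) : ℂ) ≠ 0 := Nat.cast_ne_zero.2 (Nat.succ_ne_zero N)
  have hd := differentiable_thetaProd hτ
  obtain ⟨c, hc, hc2⟩ := exists_divisionProd_add_tau hτ N
  set α : ℂ := -(-1) ^ (N + 1)
  have hα : α ≠ 0 := by simp [α]
  set β : ℂ := -(c * e (τ / 2))
  have hβ : β ≠ 0 := neg_ne_zero.2 (mul_ne_zero hc (e_ne_zero _))
  obtain ⟨H, hH, hFH, h1, h2⟩ := exists_thetaProd_quotient (m₁ := fun _ => α) (m₂ := fun _ => β) hτ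
    (differentiable_divisionProd hτ (N + 1)) (divisionProd_zero hτ N) (fun _ => hα) (fun _ => hβ)
    (by fun_prop) (by fun_prop) (fun z => by rw [divisionProd_add_one, neg_neg])
    (fun z => by
      have : e (-z - τ / 2) * e (τ / 2) = e (-z) := by rw [← e_add]; congr 1; ring
      rw [hc2]
      simp only [β]
      linear_combination -c * divisionProd τ (N + 1) z * this)
  -- The multipliers of `H z` and `H (-z)` are inverse constants, so the product is doubly periodic,
  -- hence constant. This makes `logDeriv H` take equal values at `y` and `-y`, so it drops out of
  -- the symmetrized sum.
  have hK : Differentiable ℂ fun z => H z * H (-z) := by fun_prop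
  have hconst := eq_const_of_norm_doubly_periodic hτ hK
    (fun z => by
      have a := h1 (-(z + 1))
      rw [show -(z + 1) + 1 = -z by ring] at a
      rw [h1, a]
      congr 1
      ring)
    (fun z => by
      have a := h2 (-(z + τ))
      rw [show -(z + τ) + τ = -z by ring] at a
      rw [h2, a]
      congr 1
      ring)
  have hH0 : ∀ {z : ℂ}, (∀ m n : ℤ, z ≠ m + n * τ) → H z ≠ 0 := fun hz h0 =>
    divisionProd_ne_zero hτ N hz (by rw [hFH, h0, mul_zero])
  have hlog : logDeriv H y = logDeriv H (-y) := by
    have a := logDeriv_mul (f := H) (g := fun z => H (-z)) y (hH0 hy) (hH0 (ne_lattice_neg hy))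
      (hH y) (by fun_prop)
    rw [logDeriv_comp_neg, show (fun z => H z * H (-z)) = fun _ => H 0 * H (-0) from
      funext fun z => hconst z 0, logDeriv_const] at a
    have a' : 0 = logDeriv H y + -logDeriv H (-y) := a
    linear_combination -a'
  have hF : ∀ {z : ℂ}, (∀ m n : ℤ, z ≠ m + n * τ) →
      logDeriv (divisionProd τ (N + 1)) z = logDeriv (thetaProd τ) z + logDeriv H z := by
    intro z hz
    rw [← logDeriv_mul z (thetaProd_ne_zero hτ hz) (hH0 hz) (hd z) (hH z), ← funext hFH]
  have e1 := hF hy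
  have e2 := hF (ne_lattice_neg hy)
  rw [logDeriv_divisionProd hτ N hy, div_eq_iff hN] at e1
  rw [logDeriv_divisionProd hτ N (ne_lattice_neg hy), div_eq_iff hN,
    logDeriv_thetaProd_neg hτ] at e2
  have e3 : ∀ k l : ℕ, logDeriv (thetaProd τ) ((-y + k - l * τ) / (N + 1 : ℕ)) =
      -logDeriv (thetaProd τ) ((y - k + l * τ) / (N + 1 : ℕ)) := fun k l => by
    rw [← logDeriv_thetaProd_neg hτ]
    congr 1
    ring
  simp only [e3, Finset.sum_neg_distrib] at e2
  simp only [Finset.sum_add_distrib]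
  linear_combination e1 - e2 + (N + 1 : ℕ) * hlog

/-! ### Products of two theta functions with a fixed sum of arguments -/

/-- An entire function with a double zero at the origin and the quasi-periods of
`b ↦ θ(u + b) θ(v + b)`, where `u + v = w` is not a period, vanishes. -/
theorem eq_zero_of_double_zero (hτ : 0 < τ.im) {w : ℂ} (hw : ∀ m n : ℤ, w ≠ m + n * τ)
    {F : ℂ → ℂ} (hF : Differentiable ℂ F) (h0 : F 0 = 0) (h0' : deriv F 0 = 0)
    (h1 : ∀ z, F (z + 1) = F z) (h2 : ∀ z, F (z + τ) = e (-z - τ / 2) ^ 2 * e (-w) * F z)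
    (z : ℂ) : F z = 0 := by
  have he := differentiable_e.continuous
  obtain ⟨H, hH, hFH, a1, a2⟩ := exists_thetaProd_quotient (m₁ := fun _ => -1)
    (m₂ := fun z => -e (-z - τ / 2) * e (-w)) hτ hF h0 (by simp)
    (fun z => mul_ne_zero (neg_ne_zero.2 (e_ne_zero _)) (e_ne_zero _)) (by fun_prop) (by fun_prop)
    (fun z => by rw [h1]; ring) (fun z => by rw [h2]; ring)
  -- The zero of `thetaProd` at the origin is simple, so `F' 0 = 0` forces the quotient to vanish
  -- there and permits a second division.
  have hH0 : H 0 = 0 := by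
    have hd : HasDerivAt (fun z => thetaProd τ z * H z)
        (deriv (thetaProd τ) 0 * H 0 + thetaProd τ 0 * deriv H 0) 0 :=
      ((differentiable_thetaProd hτ) 0).hasDerivAt.mul (hH 0).hasDerivAt
    rw [← funext hFH] at hd
    rw [hd.deriv, thetaProd_zero hτ, zero_mul, add_zero] at h0'
    exact (mul_eq_zero.1 h0').resolve_left (deriv_thetaProd_zero hτ)
  obtain ⟨K, hK, hHK, b1, b2⟩ := exists_thetaProd_quotient (m₁ := fun _ => 1)
    (m₂ := fun z => e (-w)) hτ hH hH0 (by simp)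
    (fun z => e_ne_zero _) (by fun_prop) (by fun_prop) a1 a2
  rw [hFH, hHK, eq_zero_of_quasiperiodic hτ hw hK (fun z => by rw [b1, one_mul]) b2 z]
  simp

/-- The normalized product `θ(u + b) θ(v + b) / (θ(u) θ(v))`. -/
noncomputable def thetaPair (τ u v b : ℂ) : ℂ :=
  thetaProd τ (u + b) / thetaProd τ u * (thetaProd τ (v + b) / thetaProd τ v)

theorem thetaPair_zero {u v : ℂ} (hu : thetaProd τ u ≠ 0) (hv : thetaProd τ v ≠ 0) :
    thetaPair τ u v 0 = 1 := by
  simp [thetaPair, hu, hv]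

theorem hasDerivAt_thetaPair_zero (hτ : 0 < τ.im) {u v : ℂ} (hu : thetaProd τ u ≠ 0)
    (hv : thetaProd τ v ≠ 0) : HasDerivAt (thetaPair τ u v)
      (logDeriv (thetaProd τ) u + logDeriv (thetaProd τ) v) 0 := by
  have hd := differentiable_thetaProd hτ
  have key : ∀ {u : ℂ}, HasDerivAt (fun b => thetaProd τ (u + b) / thetaProd τ u)
      (logDeriv (thetaProd τ) u) 0 := by
    intro u
    rw [logDeriv_apply]
    refine HasDerivAt.div_const ?_ _
    refine HasDerivAt.comp_const_add u 0 ?_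
    rw [add_zero]
    exact (hd u).hasDerivAt
  refine (key.mul key).congr_deriv ?_
  simp [hu, hv]

theorem thetaPair_add_one (u v b : ℂ) : thetaPair τ u v (b + 1) = thetaPair τ u v b := by
  unfold thetaPair
  rw [← add_assoc, ← add_assoc, thetaProd_add_one, thetaProd_add_one]
  ring

theorem thetaPair_add_tau (hτ : 0 < τ.im) {u v w : ℂ} (h : u + v = w) (b : ℂ) :
    thetaPair τ u v (b + τ) = e (-b - τ / 2) ^ 2 * e (-w) * thetaPair τ u v b := by
  unfold thetaPair
  rw [← add_assoc, ← add_assoc, thetaProd_add_tau hτ, thetaProd_add_tau hτ, ← h,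
    show -(u + b) - τ / 2 = (-b - τ / 2) + -u by ring,
    show -(v + b) - τ / 2 = (-b - τ / 2) + -v by ring,
    show -(u + v) = -u + -v by ring, e_add, e_add, e_add]
  ring

/-- A linear relation between normalized products `θ(uᵢ + b) θ(vᵢ + b) / (θ(uᵢ) θ(vᵢ))` with common
`uᵢ + vᵢ` holds as soon as it holds to first order at `b = 0`. -/
theorem thetaPair_eq_sum (hτ : 0 < τ.im) {ι : Type*} (s : Finset ι) (c u v : ι → ℂ) {u₀ v₀ w : ℂ}
    (hw : ∀ m n : ℤ, w ≠ m + n * τ) (huv₀ : u₀ + v₀ = w) (huv : ∀ i ∈ s, u i + v i = w)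
    (hu₀ : thetaProd τ u₀ ≠ 0) (hv₀ : thetaProd τ v₀ ≠ 0)
    (hu : ∀ i ∈ s, thetaProd τ (u i) ≠ 0) (hv : ∀ i ∈ s, thetaProd τ (v i) ≠ 0)
    (hc : ∑ i ∈ s, c i = 1)
    (hE : logDeriv (thetaProd τ) u₀ + logDeriv (thetaProd τ) v₀ =
      ∑ i ∈ s, c i * (logDeriv (thetaProd τ) (u i) + logDeriv (thetaProd τ) (v i))) (b : ℂ) :
    thetaPair τ u₀ v₀ b = ∑ i ∈ s, c i * thetaPair τ (u i) (v i) b := by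
  have hd := differentiable_thetaProd hτ
  have hpair : ∀ u v, Differentiable ℂ (thetaPair τ u v) := fun u v => by
    unfold thetaPair
    fun_prop
  rw [← sub_eq_zero]
  refine eq_zero_of_double_zero hτ hw
    (F := fun b => thetaPair τ u₀ v₀ b - ∑ i ∈ s, c i * thetaPair τ (u i) (v i) b)
    (by fun_prop) ?_ ?_ ?_ ?_ b
  · rw [thetaPair_zero hu₀ hv₀, Finset.sum_congr rfl fun i hi => by
      rw [thetaPair_zero (hu i hi) (hv i hi), mul_one], hc, sub_self]
  · have := (hasDerivAt_thetaPair_zero hτ hu₀ hv₀).fun_sub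
      (HasDerivAt.fun_sum fun i hi =>
        (hasDerivAt_thetaPair_zero hτ (hu i hi) (hv i hi)).const_mul (c i))
    rw [this.deriv, hE, sub_self]
  · intro z
    simp only [thetaPair_add_one]
  · intro z
    rw [mul_sub, Finset.mul_sum, thetaPair_add_tau hτ huv₀]
    congr 1
    refine Finset.sum_congr rfl fun i hi => ?_
    rw [thetaPair_add_tau hτ (huv i hi)]
    ring

/-! ### The quartic relation and the return to `delta` -/

/-- The exponent `(k + 1) * (l + 1)` is odd only when `k` and `l` are both even, and those indices
form the grid of half-periods. -/
theorem sum_range_four_sign_mul (g : ℂ → ℂ) (τ : ℂ) :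
    ∑ k ∈ Finset.range 4, ∑ l ∈ Finset.range 4,
      (-1 : ℂ) ^ ((k + 1) * (l + 1)) * g ((k : ℂ) / 4 - (l : ℂ) / 4 * τ) =
    (∑ k ∈ Finset.range 4, ∑ l ∈ Finset.range 4, g ((k : ℂ) / 4 - (l : ℂ) / 4 * τ)) -
      2 * ∑ k ∈ Finset.range 2, ∑ l ∈ Finset.range 2, g ((k : ℂ) / 2 - (l : ℂ) / 2 * τ) := by
  have h : (2 : ℂ) / 4 = 1 / 2 := by norm_num
  simp only [Finset.sum_range_succ, Finset.sum_range_zero]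
  norm_num [h]
  ring

/-- The theta product identity behind the quartic relation. -/
theorem thetaPair_quartic (hτ : 0 < τ.im) {x : ℂ} (hx : ∀ m n : ℤ, 4 * x ≠ m + n * τ) (b : ℂ) :
    thetaPair τ (-2 * x) (4 * x) b =
      (1 / 8 : ℂ) * ∑ k ∈ Finset.range 4, ∑ l ∈ Finset.range 4, (-1 : ℂ) ^ ((k + 1) * (l + 1)) *
        thetaPair τ (x + ((k : ℂ) / 4 - (l : ℂ) / 4 * τ)) (x - ((k : ℂ) / 4 - (l : ℂ) / 4 * τ)) b := by
  have h2x : ∀ m n : ℤ, 2 * x ≠ m + n * τ := fun m n h => hx (2 * m) (2 * n) (by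
    push_cast
    linear_combination 2 * h)
  have hm2x : ∀ m n : ℤ, -2 * x ≠ m + n * τ := fun m n h =>
    ne_lattice_neg h2x m n (by linear_combination h)
  have hp : ∀ k l : ℕ, thetaProd τ (x + ((k : ℂ) / 4 - (l : ℂ) / 4 * τ)) ≠ 0 := fun k l =>
    thetaProd_ne_zero hτ fun m n h => hx (4 * m - k) (4 * n + l) (by
      push_cast
      linear_combination 4 * h)
  have hm : ∀ k l : ℕ, thetaProd τ (x - ((k : ℂ) / 4 - (l : ℂ) / 4 * τ)) ≠ 0 := fun k l =>
    thetaProd_ne_zero hτ fun m n h => hx (4 * m + k) (4 * n - l) (by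
      push_cast
      linear_combination 4 * h)
  have key := thetaPair_eq_sum hτ (Finset.range 4 ×ˢ Finset.range 4)
    (fun p => 1 / 8 * (-1 : ℂ) ^ ((p.1 + 1) * (p.2 + 1)))
    (fun p => x + ((p.1 : ℂ) / 4 - (p.2 : ℂ) / 4 * τ))
    (fun p => x - ((p.1 : ℂ) / 4 - (p.2 : ℂ) / 4 * τ))
    (u₀ := -2 * x) (v₀ := 4 * x) (w := 2 * x) h2x (by ring) (fun p _ => by ring)
    (thetaProd_ne_zero hτ hm2x) (thetaProd_ne_zero hτ hx) (fun p _ => hp p.1 p.2)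
    (fun p _ => hm p.1 p.2) ?_ ?_ b
  · rw [key, Finset.sum_product]
    simp only [mul_assoc, ← Finset.mul_sum]
  · have := sum_range_four_sign_mul (fun _ => 1) τ
    simp only [mul_one] at this
    rw [Finset.sum_product]
    simp only [← Finset.mul_sum]
    rw [this]
    norm_num
  · have d4 := sum_logDeriv_thetaProd hτ 3 hx
    have d2 := sum_logDeriv_thetaProd hτ 1 h2x
    have hs := sum_range_four_sign_mul (fun y => logDeriv (thetaProd τ) (x + y) +
      logDeriv (thetaProd τ) (x - y)) τ
    have r4 : ∀ k l : ℕ, logDeriv (thetaProd τ) ((4 * x + k - l * τ) / (3 + 1 : ℕ)) +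
        logDeriv (thetaProd τ) ((4 * x - k + l * τ) / (3 + 1 : ℕ)) =
        logDeriv (thetaProd τ) (x + ((k : ℂ) / 4 - (l : ℂ) / 4 * τ)) +
        logDeriv (thetaProd τ) (x - ((k : ℂ) / 4 - (l : ℂ) / 4 * τ)) := fun k l => by
      congr 2 <;> push_cast <;> ring
    have r2 : ∀ k l : ℕ, logDeriv (thetaProd τ) ((2 * x + k - l * τ) / (1 + 1 : ℕ)) +
        logDeriv (thetaProd τ) ((2 * x - k + l * τ) / (1 + 1 : ℕ)) =
        logDeriv (thetaProd τ) (x + ((k : ℂ) / 2 - (l : ℂ) / 2 * τ)) +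
        logDeriv (thetaProd τ) (x - ((k : ℂ) / 2 - (l : ℂ) / 2 * τ)) := fun k l => by
      congr 2 <;> push_cast <;> ring
    simp only [r4] at d4
    simp only [r2] at d2
    rw [d4, d2] at hs
    rw [Finset.sum_product]
    simp only [mul_assoc, ← Finset.mul_sum]
    rw [hs, show -2 * x = -(2 * x) by ring, logDeriv_thetaProd_neg hτ]
    push_cast
    ring

/-- Numerator and denominator both have degree two in theta, so the constant relating series and
product cancels; `hd` makes it nonzero. -/
theorem Delta_eq_thetaProd (hτ : 0 < τ.im) (hd : deriv (theta τ) 0 ≠ 0) (a b : ℂ) :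
    Delta τ a b =
      deriv (thetaProd τ) 0 / thetaProd τ b * (thetaProd τ (a + b) / thetaProd τ a) := by
  obtain ⟨C, hC⟩ := exists_theta_eq_mul_thetaProd hτ
  have hdC : deriv (theta τ) 0 = C * deriv (thetaProd τ) 0 := by
    rw [funext hC, deriv_const_mul_field]
  have hC0 : C ≠ 0 := fun h => hd (by rw [hdC, h, zero_mul])
  unfold Delta
  rw [hdC, hC, hC, hC, show C * deriv (thetaProd τ) 0 * (C * thetaProd τ (a + b)) =
    C ^ 2 * (deriv (thetaProd τ) 0 * thetaProd τ (a + b)) by ring,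
    show C * thetaProd τ a * (C * thetaProd τ b) = C ^ 2 * (thetaProd τ a * thetaProd τ b) by ring,
    mul_div_mul_left _ _ (pow_ne_zero 2 hC0), mul_comm (thetaProd τ a), mul_div_mul_comm]

theorem delta_mul_delta (hτ : 0 < τ.im) (hd : deriv (theta τ) 0 ≠ 0) (u v b : ℂ) :
    delta τ (e u) (e b) * delta τ (e v) (e b) =
      (1 / (2 * Real.pi * I) * (deriv (thetaProd τ) 0 / thetaProd τ b)) ^ 2 *
        thetaPair τ u v b := by
  rw [delta_e, delta_e, Delta_eq_thetaProd hτ hd, Delta_eq_thetaProd hτ hd]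
  unfold thetaPair
  ring

end ThetaD4

theorem mainTheorem5 (τ : ℂ) (hτ : 0 < τ.im) (t h : ℂ) (ht : t ≠ 0) (hh : h ≠ 0)
    (ht_pole : ∀ n : ℤ, t ^ 4 ≠ ThetaD4.e τ ^ n)
    (hh_pole : ∀ n : ℤ, h ≠ ThetaD4.e τ ^ n) :
    ThetaD4.delta τ (t ^ (-2 : ℤ)) h * ThetaD4.delta τ (t ^ 4) h =
      (1 / 8 : ℂ) * ∑ k ∈ Finset.range 4, ∑ l ∈ Finset.range 4,
        (-1 : ℂ) ^ ((k + 1) * (l + 1)) *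
          ThetaD4.Phi τ t h ((k : ℂ) / 4 - (l : ℂ) / 4 * τ) := by
  -- If the derivative vanished, every `delta` would be zero and both sides would agree; this spares
  -- a proof that the series is not identically zero.
  by_cases hd : deriv (ThetaD4.theta τ) 0 = 0
  · simp [ThetaD4.Phi, ThetaD4.delta, ThetaD4.Delta, hd]
  obtain ⟨x, rfl⟩ := ThetaD4.exists_e_eq ht
  obtain ⟨b, rfl⟩ := ThetaD4.exists_e_eq hh
  have e4 : ThetaD4.e x ^ 4 = ThetaD4.e (4 * x) := by
    have := ThetaD4.e_int_mul 4 x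
    norm_cast at this ⊢
    rw [← this]
  have e2 : ThetaD4.e x ^ (-2 : ℤ) = ThetaD4.e (-2 * x) := by
    rw [← ThetaD4.e_int_mul]
    norm_num
  have hx : ∀ m n : ℤ, 4 * x ≠ m + n * τ := fun m n hmn => ht_pole n (by
    rw [e4, hmn, ThetaD4.e_add, (ThetaD4.e_eq_one_iff _).2 ⟨m, rfl⟩, one_mul, ThetaD4.e_int_mul])
  rw [e4, e2, ThetaD4.delta_mul_delta hτ hd, ThetaD4.thetaPair_quartic hτ hx, mul_left_comm,
    Finset.mul_sum]
  congr 1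
  refine Finset.sum_congr rfl fun k _ => ?_
  rw [Finset.mul_sum]
  refine Finset.sum_congr rfl fun l _ => ?_
  unfold ThetaD4.Phi
  rw [← ThetaD4.e_add, ← ThetaD4.e_add, ThetaD4.delta_mul_delta hτ hd, add_comm _ x,
    add_comm _ x, ← sub_eq_add_neg]
  ring
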